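/- All triangles lie in the Euclidean plane and are nondegenerate; a triangle is isosceles if at least two of its sides are equal. For a triangle $ABC$ let $A_1\in BC$, $B_1\in CA$, $C_1\in AB$ be the points where its internal angle bisectors meet the opposite sides; $A_1B_1C_1$ is the bisectral triangle of $ABC$. A Sharygin triangle is a non-isosceles triangle whose bisectral triangle is isosceles. (1) If the three vertices of a Sharygin triangle are vertices of some regular polygon, then the triangle is similar to the heptagonal triangle, that is, the triangle with angles $\pi/7$, $2\pi/7$, $4\pi/7$. (2) Up to an isometry of the plane, there is exactly one Sharygin triangle whose vertices are chosen from the vertices of a regular polygon (with any number $n\ge 3$ of vertices) inscribed in a circle of radius $1$. -/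

import Mathlib

open scoped EuclideanGeometry Real

/-- Among the three distances between the points `A`, `B`, `C`, at least two are equal. -/
def IsIsosceles (A B C : ℂ) : Prop :=
  dist A B = dist A C ∨ dist B A = dist B C ∨ dist C A = dist C B

/-- `P` is the point at which the internal bisector of the angle `BAC` meets the side `BC`. -/
def IsBisectorFoot (A B C P : ℂ) : Prop :=
  P ∈ segment ℝ B C ∧ ∠ B A P = ∠ P A C

/-- A Sharygin triangle: a (nondegenerate) non-isosceles triangle in the Euclidean plane `ℂ` whose
bisectral triangle `A₁B₁C₁` is isosceles. -/
def IsSharygin (T : Affine.Triangle ℝ ℂ) : Prop :=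
  ¬ IsIsosceles (T.points 0) (T.points 1) (T.points 2) ∧
  ∃ A₁ B₁ C₁ : ℂ,
    IsBisectorFoot (T.points 0) (T.points 1) (T.points 2) A₁ ∧
    IsBisectorFoot (T.points 1) (T.points 2) (T.points 0) B₁ ∧
    IsBisectorFoot (T.points 2) (T.points 0) (T.points 1) C₁ ∧
    IsIsosceles A₁ B₁ C₁

/-- A heptagonal triangle: its angles are `π/7`, `2π/7`, `4π/7`, in this order. -/
def IsHeptagonal (T : Affine.Triangle ℝ ℂ) : Prop :=
  ∠ (T.points 2) (T.points 0) (T.points 1) = π / 7 ∧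
  ∠ (T.points 0) (T.points 1) (T.points 2) = 2 * π / 7 ∧
  ∠ (T.points 1) (T.points 2) (T.points 0) = 4 * π / 7

/-- `V` is the vertex set of a regular polygon inscribed in a circle of radius `r`: it consists of
`n ≥ 3` points, equally spaced on a circle with center `c`; the point `c + w` is one of them. -/
def IsRegularPolygonVertexSet (r : ℝ) (V : Set ℂ) : Prop :=
  0 < r ∧ ∃ (n : ℕ) (c w : ℂ), 3 ≤ n ∧ ‖w‖ = r ∧
    V = Set.range fun k : Fin n =>
      c + w * Complex.exp (2 * (π : ℂ) * Complex.I * ((k : ℕ) : ℂ) / (n : ℂ))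

/-- The vertices of `T` are vertices of a regular polygon inscribed in a circle of radius `r`. -/
def HasVerticesInRegularPolygon (r : ℝ) (T : Affine.Triangle ℝ ℂ) : Prop :=
  ∃ V : Set ℂ, IsRegularPolygonVertexSet r V ∧ Set.range T.points ⊆ V

/-! Write a, b, c for the sides and α, β, γ for the angles. If a ≠ b, comparing the two sides of the
bisectral triangle at C₁ leaves one cubic relation in a, b, c (`dist_bisectorFoot_eq_iff`). The laws
of sines and cosines turn it into a trigonometric equation, which for s = (α + β)/2 and d = (α -
β)/2 reads cos 3s + cos(2s + d) + cos(2s - d) = 0.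

For vertices in a regular n-gon, the inscribed angle theorem makes e^{2iα} and e^{2iβ} n-th roots of
unity. The equation is then a vanishing sum of six roots of unity u^{±1}, v^{±1}, w^{±1}, where u =
t³, vw = t⁴ and t = e^{is}. Vanishing two-term subsums make one of the cosines zero. Otherwise t⁶⁰ =
1: vanishing three-term subsums are handled by hand, and a minimal six-term sum by Mann's theorem
(`div_pow_primorial_eq_one_of_minimal_sum_eq_zero`), with 2·3·5 = 30.

Elementary estimates give π/5 < s < 2π/9 when d > 0. This interval contains no multiple of π/30, so
t⁶⁰ ≠ 1, and among the cosines only cos(2s + d) can vanish. Then cos 3s = -cos(2s - d) gives s =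
3π/14 and d = π/14, the heptagonal angles. Conversely these angles satisfy the equation and occur in
the regular heptagon; angles and circumradius fix the sides, whence uniqueness. -/

/-! ### Vanishing sums of roots of unity and Mann's theorem. -/

open Polynomial in
/-- Galois conjugation of a vanishing sum of roots of unity. -/
theorem IsPrimitiveRoot.sum_pow_mul_eq_zero {ι : Type*} {N : ℕ} {ζ : ℂ} (hζ : IsPrimitiveRoot ζ N)
    (hN : 0 < N) (S : Finset ι) (a : ι → ℕ) (h : ∑ i ∈ S, ζ ^ a i = 0) {k : ℕ}
    (hk : k.Coprime N) : ∑ i ∈ S, ζ ^ (k * a i) = 0 := by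
  have hint : IsIntegral ℤ ζ := hζ.isIntegral hN
  set P : ℤ[X] := ∑ i ∈ S, X ^ a i with hP
  have hP0 : aeval ζ P = 0 := by simpa [hP] using h
  have hdvd : minpoly ℤ ζ ∣ P := minpoly.isIntegrallyClosed_dvd hint hP0
  -- `ζ` and `ζ ^ k` have the same minimal polynomial over ℤ.
  rw [hζ.minpoly_eq_pow_coprime hk] at hdvd
  obtain ⟨R, hR⟩ := hdvd
  have : aeval (ζ ^ k) P = 0 := by rw [hR]; simp
  simpa [hP, pow_mul] using this

/-- Orthogonality for the powers of a primitive root of unity of prime order. -/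
theorem IsPrimitiveRoot.sum_pow_mul_of_prime {p : ℕ} (hp : p.Prime) {ω : ℂ}
    (hω : IsPrimitiveRoot ω p) (m : ℕ) :
    ∑ j ∈ Finset.range p, ω ^ (j * m) = if p ∣ m then (p : ℂ) else 0 := by
  split_ifs with hm
  · have : ∀ j ∈ Finset.range p, ω ^ (j * m) = 1 := fun j _ =>
      (hω.pow_eq_one_iff_dvd _).2 (hm.mul_left j)
    rw [Finset.sum_congr rfl this]
    simp
  · have h1 : IsPrimitiveRoot (ω ^ m) p :=
      hω.pow_of_coprime m ((Nat.Prime.coprime_iff_not_dvd hp).2 hm).symm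
    rw [← h1.geom_sum_eq_zero hp.one_lt]
    exact Finset.sum_congr rfl fun j _ => by rw [← pow_mul, mul_comm]

/-- In a minimal vanishing sum of `N`-th roots of unity containing a `p`-th power of the primitive
root, all terms are `p`-th powers, if `p ^ 2` divides `N` or `p` exceeds the length of the sum. -/
theorem IsPrimitiveRoot.dvd_of_minimal_sum_pow_eq_zero {ι : Type*} {N : ℕ} {ζ : ℂ}
    (hζ : IsPrimitiveRoot ζ N) (hN : 0 < N) (S : Finset ι) (a : ι → ℕ)
    (h : ∑ i ∈ S, ζ ^ a i = 0)
    (hmin : ∀ T ⊆ S, T.Nonempty → ∑ i ∈ T, ζ ^ a i = 0 → T = S)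
    {p : ℕ} (hp : p.Prime) (hpN : p ∣ N) (hcase : p ∣ N / p ∨ S.card < p)
    {i₀ : ι} (hi₀ : i₀ ∈ S) (hai₀ : p ∣ a i₀) : ∀ i ∈ S, p ∣ a i := by
  obtain ⟨M, rfl⟩ := hpN
  rw [Nat.mul_div_cancel_left _ hp.pos] at hcase
  have hω : IsPrimitiveRoot (ζ ^ M) p := hζ.pow hN (mul_comm p M)
  set ω := ζ ^ M with hωdef
  -- `F j` is the given sum with `ζ` replaced by `ζ ^ (1 + j * M)`; it vanishes whenever this is a
  -- Galois conjugate. A discrete Fourier transform in `j` then isolates the terms in one residue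
  -- class of exponents mod `p`.
  set F : ℕ → ℂ := fun j => ∑ i ∈ S, ζ ^ a i * ω ^ (j * a i) with hF
  have hF0 : ∀ j, (1 + j * M).Coprime (p * M) → F j = 0 := by
    intro j hj
    rw [← hζ.sum_pow_mul_eq_zero hN S a h hj]
    refine Finset.sum_congr rfl fun i _ => ?_
    rw [hωdef, ← pow_mul, ← pow_add]
    congr 1
    ring
  have hcopM : ∀ j, (1 + j * M).Coprime M := by
    intro j
    simp
  have hclass : ∀ r, ∑ j ∈ Finset.range p, ω ^ (j * r) * F j =
      p * ∑ i ∈ S with p ∣ a i + r, ζ ^ a i := by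
    intro r
    simp only [hF, Finset.mul_sum, Finset.sum_filter]
    rw [Finset.sum_comm]
    refine Finset.sum_congr rfl fun i _ => ?_
    have : ∀ j ∈ Finset.range p, ω ^ (j * r) * (ζ ^ a i * ω ^ (j * a i)) =
        ζ ^ a i * ω ^ (j * (a i + r)) := by
      intro j _
      rw [mul_add, pow_add]
      ring
    rw [Finset.sum_congr rfl this, ← Finset.mul_sum, hω.sum_pow_mul_of_prime hp]
    split_ifs <;> ring
  have key : ∑ i ∈ S with p ∣ a i, ζ ^ a i = 0 := by
    have hall : ∀ j ∈ Finset.range p, F j = 0 := by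
      by_cases hpM : p ∣ M
      · intro j _
        refine hF0 j (Nat.Coprime.mul_right ?_ (hcopM j))
        exact Nat.Coprime.coprime_dvd_right hpM (hcopM j)
      · have hcard : S.card < p := hcase.resolve_left hpM
        -- Fewer than `p` exponents miss some class mod `p`. Since at most one `j < p` has `p ∣ 1 +
        -- j * M`, the transform at the missed class reduces to that single `F j`, which must vanish
        -- too.
        obtain ⟨r, hr⟩ : ∃ r, ∀ i ∈ S, ¬ p ∣ a i + r := by
          by_contra! hcon
          have hsub : Finset.range p ⊆ S.image fun i => a i % p := by
            intro r hr
            rw [Finset.mem_range] at hr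
            obtain ⟨i, hi, hd⟩ := hcon (p - r)
            refine Finset.mem_image.2 ⟨i, hi, ?_⟩
            have h1 : (a i + (p - r)) ≡ (r + (p - r)) [MOD p] := by
              rw [Nat.add_sub_cancel' hr.le]
              exact ((Nat.modEq_zero_iff_dvd.2 hd).trans
                (Nat.modEq_zero_iff_dvd.2 dvd_rfl).symm)
            have h2 := Nat.ModEq.add_right_cancel' _ h1
            rw [h2, Nat.mod_eq_of_lt hr]
          have := (Finset.card_le_card hsub).trans Finset.card_image_le
          rw [Finset.card_range] at this
          omega
        have hr0 := hclass r
        rw [Finset.filter_false_of_mem hr, Finset.sum_empty, mul_zero] at hr0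
        intro j hj
        by_cases hjp : p ∣ 1 + j * M
        · rw [Finset.sum_eq_single_of_mem j hj] at hr0
          · exact (mul_eq_zero.1 hr0).resolve_left (pow_ne_zero _ (hω.ne_zero hp.ne_zero))
          · intro k hk hkj
            rw [hF0 k, mul_zero]
            refine Nat.Coprime.mul_right ?_ (hcopM k)
            refine ((Nat.Prime.coprime_iff_not_dvd hp).2 fun hkp => hkj ?_).symm
            have h1 : 1 + k * M ≡ 1 + j * M [MOD p] :=
              (Nat.modEq_zero_iff_dvd.2 hkp).trans (Nat.modEq_zero_iff_dvd.2 hjp).symm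
            have h2 := Nat.ModEq.add_left_cancel' _ h1
            have h3 : k ≡ j [MOD p] :=
              Nat.ModEq.cancel_right_of_coprime ((Nat.Prime.coprime_iff_not_dvd hp).2 hpM) h2
            exact h3.eq_of_lt_of_lt (Finset.mem_range.1 hk) (Finset.mem_range.1 hj)
        · exact hF0 j (Nat.Coprime.mul_right
            ((Nat.Prime.coprime_iff_not_dvd hp).2 hjp).symm (hcopM j))
    have h0 := hclass 0
    rw [Finset.sum_eq_zero fun j hj => by rw [hall j hj, mul_zero]] at h0
    simpa [hp.ne_zero] using h0
  have hT := hmin _ (Finset.filter_subset _ S) ⟨i₀, Finset.mem_filter.2 ⟨hi₀, hai₀⟩⟩ key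
  intro i hi
  rw [← hT] at hi
  exact (Finset.mem_filter.1 hi).2

/-- **Mann's theorem**: the ratio of any two terms of a minimal vanishing sum of `n` roots of unity
has order dividing the product of the primes up to `n`. -/
theorem div_pow_primorial_eq_one_of_minimal_sum_eq_zero {ι : Type*} (S : Finset ι) (z : ι → ℂ)
    {m : ℕ} (hm : 0 < m) (hz : ∀ i ∈ S, z i ^ m = 1) (h : ∑ i ∈ S, z i = 0)
    (hmin : ∀ T ⊆ S, T.Nonempty → ∑ i ∈ T, z i = 0 → T = S)
    {i₀ : ι} (hi₀ : i₀ ∈ S) : ∀ i ∈ S, (z i / z i₀) ^ primorial S.card = 1 := by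
  classical
  have hz0 : z i₀ ≠ 0 := by
    intro h0
    have := hz i₀ hi₀
    rw [h0, zero_pow hm.ne'] at this
    exact zero_ne_one this
  have hex : ∃ N, 0 < N ∧ ∀ i ∈ S, (z i / z i₀) ^ N = 1 :=
    ⟨m, hm, fun i hi => by rw [div_pow, hz i hi, hz i₀ hi₀, div_one]⟩
  -- With `N` the least common exponent of the ratios, a prime `p ∣ N` with `p ∣ N / p` or `p >
  -- S.card` would let `N / p` serve as well.
  set N := Nat.find hex with hNdef
  obtain ⟨hN, hNz⟩ := Nat.find_spec hex
  rw [← hNdef] at hN hNz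
  have hζ : IsPrimitiveRoot (Complex.exp (2 * π * Complex.I / N)) N :=
    Complex.isPrimitiveRoot_exp N hN.ne'
  set ζ := Complex.exp (2 * π * Complex.I / N)
  have : NeZero N := ⟨hN.ne'⟩
  have hpow : ∀ i, ∃ a : ℕ, i ∈ S → ζ ^ a = z i / z i₀ := by
    intro i
    by_cases hi : i ∈ S
    · obtain ⟨a, -, ha⟩ := hζ.eq_pow_of_pow_eq_one (hNz i hi)
      exact ⟨a, fun _ => ha⟩
    · exact ⟨0, fun h' => absurd h' hi⟩
  choose a ha using hpow
  have hsum : ∀ T ⊆ S, ∑ i ∈ T, ζ ^ a i = (∑ i ∈ T, z i) / z i₀ := by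
    intro T hT
    rw [Finset.sum_div]
    exact Finset.sum_congr rfl fun i hi => ha i (hT hi)
  have hdvd0 : N ∣ a i₀ := by
    rw [← hζ.pow_eq_one_iff_dvd, ha i₀ hi₀, div_self hz0]
  have hbad : ∀ p : ℕ, p.Prime → p ∣ N → ¬ (p ∣ N / p ∨ S.card < p) := by
    intro p hp hpN hcase
    have hall := hζ.dvd_of_minimal_sum_pow_eq_zero hN S a
      (by rw [hsum S subset_rfl, h, zero_div])
      (fun T hT hne hT0 => hmin T hT hne (by
        rw [hsum T hT] at hT0
        exact (div_eq_zero_iff.1 hT0).resolve_right hz0))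
      hp hpN hcase hi₀ (hpN.trans hdvd0)
    have hlt : N / p < N := Nat.div_lt_self hN hp.one_lt
    refine Nat.find_min hex hlt ⟨Nat.div_pos (Nat.le_of_dvd hN hpN) hp.pos, fun i hi => ?_⟩
    rw [← ha i hi, ← pow_mul, hζ.pow_eq_one_iff_dvd]
    obtain ⟨b, hb⟩ := hall i hi
    exact ⟨b, by
      obtain ⟨M, hM⟩ := hpN
      rw [hb, hM, Nat.mul_div_cancel_left _ hp.pos]
      ring⟩
  have hsq : Squarefree N := by
    rw [Nat.squarefree_iff_prime_squarefree]
    rintro p hp ⟨M, hM⟩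
    have hpN : p ∣ N := ⟨p * M, by rw [hM, mul_assoc]⟩
    refine hbad p hp hpN (Or.inl ?_)
    rw [hM, mul_assoc, Nat.mul_div_cancel_left _ hp.pos]
    exact dvd_mul_right _ _
  have hdvd : N ∣ primorial S.card := by
    rw [← Nat.prod_primeFactors_of_squarefree hsq]
    refine Finset.prod_dvd_prod_of_subset _ _ _ fun p hp => ?_
    have hp' := Nat.prime_of_mem_primeFactors hp
    have := hbad p hp' (Nat.dvd_of_mem_primeFactors hp)
    simp only [Finset.mem_filter, Finset.mem_range]
    exact ⟨by omega, hp'⟩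
  intro i hi
  obtain ⟨b, hb⟩ := hdvd
  rw [hb, pow_mul, hNz i hi, one_pow]

/-! ### The six-term sum coming from three cosines. -/

/-- Three roots of unity with vanishing sum have equal cubes. -/
theorem pow_three_eq_of_add_eq_zero {x y z x' y' z' : ℂ} (hx : x * x' = 1) (hy : y * y' = 1)
    (hz : z * z' = 1) (h : x + y + z = 0) (h' : x' + y' + z' = 0) :
    x ^ 3 = y ^ 3 ∧ x ^ 3 = z ^ 3 := by
  -- The first two elementary symmetric functions vanish, so `x`, `y`, `z` are roots of X³ = xyz.
  have h2 : x * y + y * z + z * x = 0 := by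
    linear_combination x * y * z * h' - y * z * hx - x * z * hy - x * y * hz
  obtain rfl : z = -x - y := by linear_combination h
  constructor
  · linear_combination (y - x) * h2
  · linear_combination (-y - 2 * x) * h2

/-- If `x`, `x⁻¹`, `y` sum to zero and `z`, `z⁻¹`, `y⁻¹` sum to zero, then `x`, `y`, `z` are sixth
roots of unity. -/
theorem sq_pow_three_eq_one_of_add_inv_add_eq_zero {x x' y y' z z' : ℂ} (hx : x * x' = 1)
    (hy : y * y' = 1) (hz : z * z' = 1) (h : x + x' + y = 0) (h' : x + x' + y' = 0)
    (hs : z + z' + y' = 0) : (x ^ 3) ^ 2 = 1 ∧ (y ^ 3) ^ 2 = 1 ∧ (z ^ 3) ^ 2 = 1 := by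
  -- Now `y` is its own inverse, so y = ±1, and a² + ya + 1 = 0 forces a³ = y.
  obtain rfl : y' = y := by linear_combination h' - h
  have hcube : ∀ {a a' : ℂ}, a * a' = 1 → a + a' + y' = 0 → a ^ 3 = y' := by
    intro a a' ha hs
    linear_combination (a - y') * a * hs - (a - y') * ha + a * hy
  rw [hcube hx h, hcube hz hs]
  exact ⟨by rw [sq, hy], by rw [pow_right_comm, sq y', hy, one_pow], by rw [sq, hy]⟩

/-- The four cases give τ² = 1, τ¹⁰ = 1, τ⁴ = 1, and τ⁶ = τ⁸ = 1; the exponent 20 covers them all.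
It is applied with τ = t³ and U, V, W the cubes of u, v, w. -/
theorem pow_twenty_eq_one_of_cubes {τ U V W : ℂ} (hτ : τ ≠ 0) (hU : U = τ ^ 3)
    (hVW : V * W = τ ^ 4)
    (h : (V = U ∧ W = U) ∨ (V * U = 1 ∧ W * U = 1) ∨ V * W = 1 ∨
      (U ^ 2 = 1 ∧ V ^ 2 = 1 ∧ W ^ 2 = 1)) : τ ^ 20 = 1 := by
  rcases h with ⟨rfl, rfl⟩ | ⟨h1, h2⟩ | h1 | ⟨h1, h2, h3⟩
  · subst hU
    have h3 : τ ^ 2 = 1 := by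
      apply mul_left_cancel₀ (pow_ne_zero 4 hτ)
      linear_combination hVW
    calc τ ^ 20 = (τ ^ 2) ^ 10 := by ring
      _ = 1 := by rw [h3, one_pow]
  · have h3 : τ ^ 10 = 1 := by
      subst hU
      linear_combination h1 - τ ^ 6 * hVW + V * τ ^ 3 * h2
    calc τ ^ 20 = (τ ^ 10) ^ 2 := by ring
      _ = 1 := by rw [h3, one_pow]
  · have h3 : τ ^ 4 = 1 := by rw [← hVW, h1]
    calc τ ^ 20 = (τ ^ 4) ^ 5 := by ring
      _ = 1 := by rw [h3, one_pow]
  · have h4 : τ ^ 6 = 1 := by rw [← h1, hU]; ring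
    have h5 : τ ^ 8 = 1 := by
      calc τ ^ 8 = (V * W) ^ 2 := by rw [hVW]; ring
        _ = 1 := by rw [mul_pow, h2, h3, one_mul]
    calc τ ^ 20 = (τ ^ 6) ^ 2 * τ ^ 8 := by ring
      _ = 1 := by rw [h4, h5]; simp

set_option maxHeartbeats 1000000 in
/-- Cubes of the roots of unity in a pair of complementary vanishing sums of three terms chosen
from `u`, `u⁻¹`, `v`, `v⁻¹`, `w`, `w⁻¹`. -/
theorem cubes_of_add_eq_zero {u u' v v' w w' : ℂ} (huu : u * u' = 1) (hvv : v * v' = 1)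
    (hww : w * w' = 1) (hsum : u + u' + v + v' + w + w' = 0) {i j k : Fin 6} (hij : i < j)
    (hjk : j < k)
    (h : ![u, u', v, v', w, w'] i + ![u, u', v, v', w, w'] j + ![u, u', v, v', w, w'] k = 0)
    (h' : ![u', u, v', v, w', w] i + ![u', u, v', v, w', w] j + ![u', u, v', v, w', w] k = 0)
    (hc : ![u, u', v, v', w, w'] i ^ 3 = ![u, u', v, v', w, w'] j ^ 3 ∧
      ![u, u', v, v', w, w'] i ^ 3 = ![u, u', v, v', w, w'] k ^ 3) :
    (v ^ 3 = u ^ 3 ∧ w ^ 3 = u ^ 3) ∨ (v ^ 3 * u ^ 3 = 1 ∧ w ^ 3 * u ^ 3 = 1) ∨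
      v ^ 3 * w ^ 3 = 1 ∨ ((u ^ 3) ^ 2 = 1 ∧ (v ^ 3) ^ 2 = 1 ∧ (w ^ 3) ^ 2 = 1) := by
  have hUU : u ^ 3 * u' ^ 3 = 1 := by rw [← mul_pow, huu, one_pow]
  have hVV : v ^ 3 * v' ^ 3 = 1 := by rw [← mul_pow, hvv, one_pow]
  have hWW : w ^ 3 * w' ^ 3 = 1 := by rw [← mul_pow, hww, one_pow]
  have key := @sq_pow_three_eq_one_of_add_inv_add_eq_zero
  fin_cases i <;> fin_cases j <;> first
    | exact absurd hij (by decide)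
    | (fin_cases k <;> first
        | exact absurd hjk (by decide)
        | (clear hij hjk
           simp only [Fin.reduceFinMk, Fin.zero_eta, Fin.mk_one, Matrix.cons_val] at h h' hc
           -- Twelve triples contain an inverse pair, and the complementary triple then does as
           -- well: these are the twelve uses of `key`. The other eight take one element from each
           -- pair, and equality of cubes suffices.
           first
            | (have h2 := key huu hvv hww (by linear_combination h) (by linear_combination h')
                 (by linear_combination hsum - h); exact Or.inr (Or.inr (Or.inr (by simp [h2]))))
            | (have h2 := key huu hvv hww (by linear_combination h') (by linear_combination h)
                 (by linear_combination hsum - h'); exact Or.inr (Or.inr (Or.inr (by simp [h2]))))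
            | (have h2 := key huu hww hvv (by linear_combination h) (by linear_combination h')
                 (by linear_combination hsum - h); exact Or.inr (Or.inr (Or.inr (by simp [h2]))))
            | (have h2 := key huu hww hvv (by linear_combination h') (by linear_combination h)
                 (by linear_combination hsum - h'); exact Or.inr (Or.inr (Or.inr (by simp [h2]))))
            | (have h2 := key hvv huu hww (by linear_combination h) (by linear_combination h')
                 (by linear_combination hsum - h); exact Or.inr (Or.inr (Or.inr (by simp [h2]))))
            | (have h2 := key hvv huu hww (by linear_combination h') (by linear_combination h)
                 (by linear_combination hsum - h'); exact Or.inr (Or.inr (Or.inr (by simp [h2]))))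
            | (have h2 := key hvv hww huu (by linear_combination h) (by linear_combination h')
                 (by linear_combination hsum - h); exact Or.inr (Or.inr (Or.inr (by simp [h2]))))
            | (have h2 := key hvv hww huu (by linear_combination h') (by linear_combination h)
                 (by linear_combination hsum - h'); exact Or.inr (Or.inr (Or.inr (by simp [h2]))))
            | (have h2 := key hww huu hvv (by linear_combination h) (by linear_combination h')
                 (by linear_combination hsum - h); exact Or.inr (Or.inr (Or.inr (by simp [h2]))))
            | (have h2 := key hww huu hvv (by linear_combination h') (by linear_combination h)
                 (by linear_combination hsum - h'); exact Or.inr (Or.inr (Or.inr (by simp [h2]))))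
            | (have h2 := key hww hvv huu (by linear_combination h) (by linear_combination h')
                 (by linear_combination hsum - h); exact Or.inr (Or.inr (Or.inr (by simp [h2]))))
            | (have h2 := key hww hvv huu (by linear_combination h') (by linear_combination h)
                 (by linear_combination hsum - h'); exact Or.inr (Or.inr (Or.inr (by simp [h2]))))
            | (clear h h' hsum huu hvv hww key
               generalize u ^ 3 = U, v ^ 3 = V, w ^ 3 = W, u' ^ 3 = U', v' ^ 3 = V',
                 w' ^ 3 = W' at *
               grind)))

/-- Three cosines of rational angles `3s`, `2s + d`, `2s - d` with sum zero, in terms of the roots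
of unity `u`, `v`, `w`, where `t` stands for `exp (i s)`. -/
theorem sq_eq_neg_one_or_pow_eq_one_of_sum_add_inv_eq_zero {t u v w : ℂ} {m : ℕ} (hm : 0 < m)
    (ht : t ^ m = 1) (hv : v ^ m = 1) (hw : w ^ m = 1) (hu3 : u = t ^ 3) (hvw : v * w = t ^ 4)
    (hsum : u + u⁻¹ + v + v⁻¹ + w + w⁻¹ = 0) :
    (u ^ 2 = -1 ∨ v ^ 2 = -1 ∨ w ^ 2 = -1) ∨ t ^ 60 = 1 := by
  have hne : ∀ {x : ℂ}, x ^ m = 1 → x ≠ 0 := by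
    rintro x hx rfl
    rw [zero_pow hm.ne'] at hx
    exact zero_ne_one hx
  have ht0 := hne ht
  have hv0 := hne hv
  have hw0 := hne hw
  have hu : u ^ m = 1 := by rw [hu3, ← pow_mul, mul_comm, pow_mul, ht, one_pow]
  have hu0 := hne hu
  have huu := mul_inv_cancel₀ hu0
  have hvv := mul_inv_cancel₀ hv0
  have hww := mul_inv_cancel₀ hw0
  have hconj : ∀ {x : ℂ}, x ^ m = 1 → (starRingEnd ℂ) x = x⁻¹ := fun hx =>
    (Complex.inv_eq_conj (Complex.norm_eq_one_of_pow_eq_one hx hm.ne')).symm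
  generalize hu' : u⁻¹ = u' at *
  generalize hv' : v⁻¹ = v' at *
  generalize hw' : w⁻¹ = w' at *
  have hu'm : u' ^ m = 1 := by rw [← hu', inv_pow, hu, inv_one]
  have hv'm : v' ^ m = 1 := by rw [← hv', inv_pow, hv, inv_one]
  have hw'm : w' ^ m = 1 := by rw [← hw', inv_pow, hw, inv_one]
  set z : Fin 6 → ℂ := ![u, u', v, v', w, w'] with hz
  have hzm : ∀ i, z i ^ m = 1 := by
    intro i
    fin_cases i <;> simpa [hz]
  have hz0 : ∀ i, z i ≠ 0 := fun i => hne (hzm i)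
  have hzsum : ∑ i, z i = 0 := by
    rw [Fin.sum_univ_six]
    simpa [hz] using hsum
  by_cases hpair : ∃ i j, i < j ∧ z i + z j = 0
  · left
    obtain ⟨i, j, hij, h⟩ := hpair
    -- If the two terms are not mutually inverse, their inverses also cancel, leaving x + x⁻¹ = 0
    -- for the third pair.
    fin_cases i <;> fin_cases j <;> first
      | exact absurd hij (by decide)
      | (simp [hz] at h; clear hz hzm hz0 hzsum hu3 hvw; clear_value z; grind)
  right
  push Not at hpair
  have hτ0 : t ^ 3 ≠ 0 := pow_ne_zero 3 ht0
  have htriple : ∀ i j k, i < j → j < k → z i + z j + z k = 0 → t ^ 60 = 1 := by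
    intro i j k hij hjk h
    -- Complex conjugation inverts roots of unity.
    have h' : (z i)⁻¹ + (z j)⁻¹ + (z k)⁻¹ = 0 := by
      rw [← hconj (hzm i), ← hconj (hzm j), ← hconj (hzm k), ← map_add, ← map_add, h, map_zero]
    have hc := pow_three_eq_of_add_eq_zero (mul_inv_cancel₀ (hz0 i)) (mul_inv_cancel₀ (hz0 j))
      (mul_inv_cancel₀ (hz0 k)) h h'
    have hinv : ∀ l, (z l)⁻¹ = ![u', u, v', v, w', w] l := by
      intro l
      fin_cases l <;> simp [hz, ← hu', ← hv', ← hw']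
    rw [hinv, hinv, hinv] at h'
    have hcubes := cubes_of_add_eq_zero huu hvv hww hsum hij hjk h h' hc
    have := pow_twenty_eq_one_of_cubes hτ0 (by rw [hu3]) (by rw [← mul_pow, hvw]; ring) hcubes
    rw [← this]
    ring
  have hsmall : ∀ T : Finset (Fin 6), T.Nonempty → T.card ≤ 3 → ∑ i ∈ T, z i = 0 →
      t ^ 60 = 1 := by
    intro T hT hcard h
    have hpos := hT.card_pos
    obtain h1 | h1 | h1 : T.card = 1 ∨ T.card = 2 ∨ T.card = 3 := by omega
    · obtain ⟨i, rfl⟩ := Finset.card_eq_one.1 h1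
      exact absurd (by simpa using h) (hz0 i)
    · obtain ⟨i, j, hij, rfl⟩ := Finset.card_eq_two.1 h1
      rw [Finset.sum_pair hij] at h
      rcases hij.lt_or_gt with hlt | hlt
      · exact absurd h (hpair i j hlt)
      · exact absurd (by rw [add_comm, h]) (hpair j i hlt)
    · set f := T.orderEmbOfFin h1 with hf
      have himg : T = Finset.univ.image f := by
        rw [hf]; exact (Finset.image_orderEmbOfFin_univ T h1).symm
      rw [himg, Finset.sum_image (fun _ _ _ _ hxy => f.injective hxy), Fin.sum_univ_three] at h
      exact htriple _ _ _ (f.strictMono (by decide)) (f.strictMono (by decide)) h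
  by_contra hcon
  have hmin : ∀ T ⊆ (Finset.univ : Finset (Fin 6)), T.Nonempty → ∑ i ∈ T, z i = 0 →
      T = Finset.univ := by
    intro T _ hT h
    by_contra hne
    have hsplit := Finset.sum_add_sum_compl T z
    rw [h, hzsum, zero_add] at hsplit
    have hcc := Finset.card_add_card_compl T
    rw [Fintype.card_fin] at hcc
    rcases le_or_gt T.card 3 with hle | hgt
    · exact hcon (hsmall T hT hle h)
    · refine hcon (hsmall Tᶜ ?_ (by omega) hsplit)
      rw [Finset.nonempty_iff_ne_empty, Ne, Finset.compl_eq_empty_iff]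
      exact hne
  have hmann := fun i₀ => div_pow_primorial_eq_one_of_minimal_sum_eq_zero Finset.univ z hm
    (fun i _ => hzm i) hzsum hmin (Finset.mem_univ i₀)
  have h30 : primorial (Finset.univ : Finset (Fin 6)).card = 30 := by decide
  simp only [h30] at hmann
  -- The ratios u/u⁻¹ = t⁶ and w/v⁻¹ = t⁴ are 30th roots of unity, so t¹⁸⁰ = t¹²⁰ = 1.
  have e1 : (u * u) ^ 30 = 1 := by
    have := hmann 1 0 (Finset.mem_univ 0)
    simpa [hz, ← hu', div_eq_mul_inv] using this
  have e2 : (w * v) ^ 30 = 1 := by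
    have := hmann 3 4 (Finset.mem_univ 4)
    simpa [hz, ← hv', div_eq_mul_inv] using this
  apply hcon
  rw [hu3] at e1
  rw [mul_comm w v, hvw] at e2
  calc t ^ 60 = (t ^ 4) ^ 30 * t ^ 60 := by rw [e2, one_mul]
    _ = (t ^ 3 * t ^ 3) ^ 30 := by ring
    _ = 1 := e1

/-! ### The trigonometric equation in rational angles. -/

open Real in
/-- The condition `2 cos γ (sin α + sin β + sin γ) + sin γ = 0` for the angles of a triangle, as a
sum of three cosines. -/
theorem two_mul_cos_mul_add_sin_eq {α β γ : ℝ} (h : α + β + γ = π) :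
    2 * cos γ * (sin α + sin β + sin γ) + sin γ =
      -(2 * sin ((α + β) / 2)) * (cos (3 * ((α + β) / 2)) + cos (2 * ((α + β) / 2) + (α - β) / 2) +
        cos (2 * ((α + β) / 2) - (α - β) / 2)) := by
  obtain ⟨s, hs⟩ : ∃ s, s = (α + β) / 2 := ⟨_, rfl⟩
  obtain ⟨d, hd⟩ : ∃ d, d = (α - β) / 2 := ⟨_, rfl⟩
  rw [← hs, ← hd]
  obtain rfl : α = s + d := by linarith
  obtain rfl : β = s - d := by linarith
  obtain rfl : γ = π - 2 * s := by linarith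
  rw [cos_pi_sub, sin_pi_sub, sin_add, sin_sub, cos_add, cos_sub, cos_three_mul, sin_two_mul,
    cos_two_mul]
  ring

open Real in
/-- Bounds for `s` imposed by `cos 3s + cos (2s + d) + cos (2s - d) = 0`. -/
theorem bounds_of_sum_cos_eq_zero {s d : ℝ} (hd : 0 < d) (hds : d < s) (hs : s < π / 2)
    (h : cos (3 * s) + cos (2 * s + d) + cos (2 * s - d) = 0) :
    π / 5 < s ∧ s < 2 * π / 9 := by
  have hπ := pi_pos
  have hc0 : 0 < cos s := cos_pos_of_mem_Ioo ⟨by linarith, hs⟩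
  have hce : cos s < cos d := cos_lt_cos_of_nonneg_of_le_pi hd.le (by linarith) hds
  have he1 : cos d < 1 := by
    rw [← cos_zero]
    exact cos_lt_cos_of_nonneg_of_le_pi le_rfl (by linarith) hd
  have hrel : 4 * cos s ^ 3 - 3 * cos s + 2 * (2 * cos s ^ 2 - 1) * cos d = 0 := by
    rw [cos_add, cos_sub, cos_three_mul, cos_two_mul] at h
    linarith
  generalize hc : cos s = c at *
  generalize cos d = e at *
  -- The relation is linear in `e`, and c < e < 1. Replacing `e` by `c` gives 8c³ - 5c < 0;
  -- replacing it by 1 gives (2c + 1)(2c² + c - 2) > 0, so c > (√17 - 1)/4 > 0.78.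
  have hpos : 0 < 2 * c ^ 2 - 1 := by
    by_contra hcon
    nlinarith [mul_nonneg (sub_nonneg.2 (not_lt.1 hcon)) (sub_nonneg.2 hce.le)]
  have hupper : c ^ 2 < 5 / 8 := by
    have := mul_pos hpos (sub_pos.2 hce)
    by_contra hcon
    nlinarith
  have hlower : 78 / 100 < c := by
    have h1 := mul_pos hpos (sub_pos.2 he1)
    have h2 : 0 < (2 * c + 1) * (2 * c ^ 2 + c - 2) := by nlinarith
    have h3 := (mul_pos_iff_of_pos_left (by linarith)).1 h2
    nlinarith
  constructor
  · by_contra hcon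
    have h1 : cos (π / 5) ≤ cos s :=
      cos_le_cos_of_nonneg_of_le_pi (by linarith) (by linarith) (not_lt.1 hcon)
    rw [cos_pi_div_five, hc] at h1
    have h5 : (2.2 : ℝ) < √5 := by
      rw [Real.lt_sqrt (by norm_num)]
      norm_num
    nlinarith
  · by_contra hcon
    have h1 : cos s ≤ cos (2 * π / 9) :=
      cos_le_cos_of_nonneg_of_le_pi (by positivity) (by linarith) (not_lt.1 hcon)
    have h3 : cos (3 * (2 * π / 9)) = -1 / 2 := by
      rw [show 3 * (2 * π / 9) = π - π / 3 by ring, cos_pi_sub, cos_pi_div_three]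
      norm_num
    rw [cos_three_mul] at h3
    rw [hc] at h1
    generalize cos (2 * π / 9) = x at *
    nlinarith [mul_pos (sub_pos.2 (hlower.trans_le h1)) (sub_pos.2 (hlower.trans_le h1)),
      mul_pos (mul_pos (sub_pos.2 (hlower.trans_le h1)) (sub_pos.2 (hlower.trans_le h1)))
        (sub_pos.2 (hlower.trans_le h1))]

open Real in
/-- The solution of `cos 3s + cos (2s + d) + cos (2s - d) = 0` in rational angles. -/
theorem sum_cos_eq_zero_of_rational {s d : ℝ} {m : ℕ} (hm : 0 < m)
    (hsm : Complex.exp (s * Complex.I) ^ m = 1) (hdm : Complex.exp (d * Complex.I) ^ m = 1)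
    (hd : 0 < d) (hds : d < s) (hs : s < π / 2)
    (h : cos (3 * s) + cos (2 * s + d) + cos (2 * s - d) = 0) :
    s = 3 * π / 14 ∧ d = π / 14 := by
  obtain ⟨hs1, hs2⟩ := bounds_of_sum_cos_eq_zero hd hds hs h
  have hπ := pi_pos
  set t := Complex.exp (s * Complex.I) with ht
  set q := Complex.exp (d * Complex.I) with hq
  have hexp : ∀ x : ℝ, Complex.exp (x * Complex.I) + (Complex.exp (x * Complex.I))⁻¹ =
      ((2 * cos x : ℝ) : ℂ) := by
    intro x
    rw [← Complex.exp_neg]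
    push_cast
    rw [Complex.two_cos]
    ring_nf
  have hsq : ∀ x : ℝ, Complex.exp (x * Complex.I) ^ 2 = -1 → cos x = 0 := by
    intro x hx
    have h1 := hexp x
    have h0 : Complex.exp (x * Complex.I) ≠ 0 := Complex.exp_ne_zero _
    have h2 : Complex.exp (x * Complex.I) + (Complex.exp (x * Complex.I))⁻¹ = 0 := by
      field_simp
      rw [hx]
      ring
    rw [h2] at h1
    have h3 : 2 * cos x = 0 := by exact_mod_cast h1.symm
    linarith
  have hu : Complex.exp ((3 * s : ℝ) * Complex.I) = t ^ 3 := by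
    rw [ht, ← Complex.exp_nat_mul]
    push_cast
    ring_nf
  have hv : Complex.exp ((2 * s + d : ℝ) * Complex.I) = t ^ 2 * q := by
    rw [ht, hq, ← Complex.exp_nat_mul, ← Complex.exp_add]
    push_cast
    ring_nf
  have hw : Complex.exp ((2 * s - d : ℝ) * Complex.I) = t ^ 2 * q⁻¹ := by
    rw [ht, hq, ← Complex.exp_nat_mul, ← Complex.exp_neg, ← Complex.exp_add]
    push_cast
    ring_nf
  have hq0 : q ≠ 0 := Complex.exp_ne_zero _
  have hcases := sq_eq_neg_one_or_pow_eq_one_of_sum_add_inv_eq_zero (t := t) (u := t ^ 3)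
    (v := t ^ 2 * q) (w := t ^ 2 * q⁻¹) hm hsm
    (by rw [mul_pow, hdm, ← pow_mul, mul_comm 2 m, pow_mul, hsm]; simp)
    (by rw [mul_pow, inv_pow, hdm, ← pow_mul, mul_comm 2 m, pow_mul, hsm]; simp) rfl
    (by field_simp)
    (by
      rw [← hu, ← hv, ← hw]
      have : ((2 * cos (3 * s) : ℝ) : ℂ) + ((2 * cos (2 * s + d) : ℝ) : ℂ) +
          ((2 * cos (2 * s - d) : ℝ) : ℂ) = 0 := by
        rw [← Complex.ofReal_add, ← Complex.ofReal_add, Complex.ofReal_eq_zero]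
        linarith
      rw [← hexp, ← hexp, ← hexp] at this
      linear_combination this)
  have hds' : 2 * s + d < π := by linarith
  have hmid : cos (π / 2) = 0 := cos_pi_div_two
  rcases hcases with (h1 | h1 | h1) | h1
  · exfalso
    rw [← hu] at h1
    have h3 := hsq _ h1
    have : 3 * s = π / 2 := injOn_cos ⟨by linarith, by linarith⟩ ⟨by linarith, by linarith⟩
      (h3.trans hmid.symm)
    linarith
  · rw [← hv] at h1
    have h3 := hsq _ h1
    have h4 : 2 * s + d = π / 2 := injOn_cos ⟨by linarith, by linarith⟩
      ⟨by linarith, by linarith⟩ (h3.trans hmid.symm)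
    have h5 : cos (3 * s) = cos (π - (2 * s - d)) := by
      rw [cos_pi_sub]
      linarith
    have h6 : 3 * s = π - (2 * s - d) := injOn_cos ⟨by linarith, by linarith⟩
      ⟨by linarith, by linarith⟩ h5
    constructor <;> linarith
  · exfalso
    rw [← hw] at h1
    have h3 := hsq _ h1
    have : 2 * s - d = π / 2 := injOn_cos ⟨by linarith, by linarith⟩ ⟨by linarith, by linarith⟩
      (h3.trans hmid.symm)
    linarith
  · exfalso
    rw [ht, ← Complex.exp_nat_mul, Complex.exp_eq_one_iff] at h1
    obtain ⟨n, hn⟩ := h1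
    have h2 : 60 * s = n * (2 * π) := by
      have : ((60 * s : ℝ) : ℂ) = ((n * (2 * π) : ℝ) : ℂ) := by
        apply mul_right_cancel₀ Complex.I_ne_zero
        push_cast
        linear_combination hn
      exact_mod_cast this
    -- The bounds on `s` put n = 30s/π strictly between 6 and 20/3.
    have h3 : (6 : ℝ) < n := by nlinarith
    have h4 : (n : ℝ) < 7 := by nlinarith
    have h5 : (6 : ℤ) < n := by exact_mod_cast h3
    have h6 : n < (7 : ℤ) := by exact_mod_cast h4
    omega

open Real in
/-- The only rational angles of a scalene triangle satisfying
`2 cos γ (sin α + sin β + sin γ) + sin γ = 0` are `π/7`, `2π/7`, `4π/7`. -/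
theorem angles_eq_of_rational {α β γ : ℝ} (hα : 0 < α) (hβ : 0 < β) (hγ : 0 < γ)
    (hsum : α + β + γ = π) (hne : α ≠ β)
    (h : 2 * cos γ * (sin α + sin β + sin γ) + sin γ = 0) {m : ℕ} (hm : 0 < m)
    (hαm : Complex.exp (2 * α * Complex.I) ^ m = 1)
    (hβm : Complex.exp (2 * β * Complex.I) ^ m = 1) :
    γ = 4 * π / 7 ∧ ((α = π / 7 ∧ β = 2 * π / 7) ∨ (α = 2 * π / 7 ∧ β = π / 7)) := by
  wlog hlt : β < α generalizing α β
  · obtain ⟨h1, h2⟩ := this hβ hα (by linarith) hne.symm (by linarith) hβm hαm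
      (lt_of_le_of_ne (not_lt.1 hlt) hne)
    exact ⟨h1, by tauto⟩
  have hexp : ∀ {x y z : ℝ}, Complex.exp (2 * x * Complex.I) ^ m = 1 →
      Complex.exp (2 * y * Complex.I) ^ m = 1 → (2 * z = x + y ∨ 2 * z = x - y) →
      Complex.exp (z * Complex.I) ^ (4 * m) = 1 := by
    intro x y z hx hy hz
    rw [pow_mul, ← Complex.exp_nat_mul]
    rcases hz with hz | hz
    · rw [show ((4 : ℕ) : ℂ) * (z * Complex.I) = 2 * x * Complex.I + 2 * y * Complex.I by
        have : (2 : ℂ) * z = x + y := by exact_mod_cast hz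
        push_cast
        linear_combination 2 * Complex.I * this, Complex.exp_add, mul_pow, hx, hy, one_mul]
    · rw [show ((4 : ℕ) : ℂ) * (z * Complex.I) = 2 * x * Complex.I - 2 * y * Complex.I by
        have : (2 : ℂ) * z = x - y := by exact_mod_cast hz
        push_cast
        linear_combination 2 * Complex.I * this, Complex.exp_sub, div_pow, hx, hy, div_one]
  rw [two_mul_cos_mul_add_sin_eq hsum] at h
  have hsin : 0 < sin ((α + β) / 2) := sin_pos_of_pos_of_lt_pi (by linarith) (by linarith)
  have h0 := (mul_eq_zero.1 h).resolve_left (by linarith)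
  obtain ⟨h1, h2⟩ := sum_cos_eq_zero_of_rational (m := 4 * m) (by positivity)
    (hexp hαm hβm (Or.inl (by ring))) (hexp hαm hβm (Or.inr (by ring)))
    (by linarith) (by linarith) (by linarith) h0
  exact ⟨by linarith, Or.inr ⟨by linarith, by linarith⟩⟩

/-! ### Bisector feet and the cubic relation between the sides. -/

open InnerProductGeometry

/-- The **angle bisector theorem**. -/
theorem isBisectorFoot_iff {A B C P : ℂ} (hABC : ¬ Collinear ℝ {A, B, C}) :
    IsBisectorFoot A B C P ↔
      P = (dist C A / (dist C A + dist A B)) • B + (dist A B / (dist C A + dist A B)) • C := by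
  have hangle : ∠ B A C ≠ 0 := fun h => hABC (by
    rw [Set.insert_comm]
    exact EuclideanGeometry.collinear_of_angle_eq_zero h)
  have hBA : B ≠ A := by
    rintro rfl
    simp [collinear_pair] at hABC
  have hCA : C ≠ A := by
    rintro rfl
    simp [Set.pair_comm, collinear_pair] at hABC
  have hp : 0 < ‖B - A‖ := norm_pos_iff.2 (sub_ne_zero.2 hBA)
  have hq : 0 < ‖C - A‖ := norm_pos_iff.2 (sub_ne_zero.2 hCA)
  have hpq : inner ℝ (B - A) (C - A) ≠ ‖B - A‖ * ‖C - A‖ := by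
    rw [Ne, inner_eq_mul_norm_iff_angle_eq_zero (sub_ne_zero.2 hBA) (sub_ne_zero.2 hCA)]
    exact hangle
  have hbis : ∀ t : ℝ, P = (1 - t) • B + t • C → P ≠ A →
      (∠ B A P = ∠ P A C ↔ t * (‖B - A‖ + ‖C - A‖) = ‖B - A‖) := by
    intro t ht hPA
    have hx : 0 < ‖P - A‖ := norm_pos_iff.2 (sub_ne_zero.2 hPA)
    have hxe : P - A = (1 - t) • (B - A) + t • (C - A) := by
      rw [ht]
      module
    have h1 : ∠ B A P = ∠ P A C ↔
        inner ℝ (B - A) (P - A) / (‖B - A‖ * ‖P - A‖) =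
          inner ℝ (P - A) (C - A) / (‖P - A‖ * ‖C - A‖) := by
      constructor
      · intro h
        have := congrArg Real.cos h
        simpa only [EuclideanGeometry.angle, vsub_eq_sub, cos_angle] using this
      · intro h
        simp only [EuclideanGeometry.angle, vsub_eq_sub, angle, h]
    rw [h1, div_eq_div_iff (by positivity) (by positivity)]
    have e1 : inner ℝ (B - A) (P - A) =
        (1 - t) * ‖B - A‖ ^ 2 + t * inner ℝ (B - A) (C - A) := by
      rw [hxe, inner_add_right, real_inner_smul_right, real_inner_smul_right,
        real_inner_self_eq_norm_sq]
    have e2 : inner ℝ (P - A) (C - A) =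
        (1 - t) * inner ℝ (B - A) (C - A) + t * ‖C - A‖ ^ 2 := by
      rw [hxe, inner_add_left, real_inner_smul_left, real_inner_smul_left,
        real_inner_self_eq_norm_sq]
    rw [e1, e2]
    generalize inner ℝ (B - A) (C - A) = k at *
    generalize ‖P - A‖ = x at *
    generalize ‖B - A‖ = p at *
    generalize ‖C - A‖ = q at *
    -- Equality of cosines factors; p·q ≠ k because the angle at `A` is nonzero, which leaves the
    -- linear condition on `t`.
    rw [← sub_eq_zero]
    have : ((1 - t) * p ^ 2 + t * k) * (x * q) - ((1 - t) * k + t * q ^ 2) * (p * x) =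
        x * (p * q - k) * (p - t * (p + q)) := by ring
    rw [this, mul_eq_zero, mul_eq_zero, or_iff_right, sub_eq_zero, eq_comm]
    rintro (h | h)
    · exact hx.ne' h
    · exact hpq (by linarith)
  -- The point `A` itself must be excluded: there both angles equal π/2 by convention.
  have hne : ∀ t : ℝ, 0 ≤ t → t ≤ 1 → (1 - t) • B + t • C ≠ A := by
    intro t h0 h1 h
    apply hABC
    have : A ∈ segment ℝ B C := ⟨1 - t, t, by linarith, h0, by ring, h⟩
    rw [Set.insert_comm]
    exact (mem_segment_iff_wbtw.1 this).collinear
  rw [dist_eq_norm C A, dist_comm A B, dist_eq_norm B A]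
  have hfrac : ‖C - A‖ / (‖C - A‖ + ‖B - A‖) = 1 - ‖B - A‖ / (‖C - A‖ + ‖B - A‖) := by
    field_simp
    ring
  rw [hfrac]
  constructor
  · rintro ⟨⟨s, t, hs, ht, hst, rfl⟩, hang⟩
    obtain rfl : s = 1 - t := by linarith
    have := (hbis t rfl (hne t ht (by linarith))).1 hang
    have ht' : t = ‖B - A‖ / (‖C - A‖ + ‖B - A‖) := by
      field_simp
      linarith
    rw [← ht']
  · intro h
    have h0 : 0 ≤ ‖B - A‖ / (‖C - A‖ + ‖B - A‖) := by positivity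
    have h1 : ‖B - A‖ / (‖C - A‖ + ‖B - A‖) ≤ 1 := by
      rw [div_le_one (by positivity)]
      linarith
    refine ⟨⟨_, _, by linarith, h0, by ring, h.symm⟩, ?_⟩
    refine (hbis _ h (by rw [h]; exact hne _ h0 h1)).2 ?_
    field_simp
    ring

theorem norm_smul_add_smul_sq (x y : ℝ) (p q : ℂ) :
    ‖x • p + y • q‖ ^ 2 = x ^ 2 * ‖p‖ ^ 2 + x * y * (‖p‖ ^ 2 + ‖q‖ ^ 2 - ‖q - p‖ ^ 2) +
      y ^ 2 * ‖q‖ ^ 2 := by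
  rw [norm_add_sq_real, norm_sub_sq_real, real_inner_smul_left, real_inner_smul_right, norm_smul,
    norm_smul, mul_pow, mul_pow, Real.norm_eq_abs, Real.norm_eq_abs, sq_abs, sq_abs,
    real_inner_comm p q]
  ring

theorem not_collinear_rotate {A B C : ℂ} (h : ¬ Collinear ℝ {A, B, C}) :
    ¬ Collinear ℝ {B, C, A} := by
  rwa [Set.insert_comm, Set.pair_comm A C] at h

theorem dist_pos_of_not_collinear {A B C : ℂ} (h : ¬ Collinear ℝ {A, B, C}) : 0 < dist A B :=
  dist_pos.2 (ne₁₂_of_not_collinear h)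

/-- The sides of the bisectral triangle at the foot `C₁` are equal if and only if the sides of the
triangle at `C` are equal or satisfy a cubic relation. -/
theorem dist_bisectorFoot_eq_iff {A B C A₁ B₁ C₁ : ℂ} (hABC : ¬ Collinear ℝ {A, B, C})
    (hA : IsBisectorFoot A B C A₁) (hB : IsBisectorFoot B C A B₁) (hC : IsBisectorFoot C A B C₁)
    (hab : dist B C ≠ dist C A) :
    dist C₁ A₁ = dist C₁ B₁ ↔
      (dist B C + dist C A + dist A B) * (dist B C ^ 2 + dist C A ^ 2 - dist A B ^ 2) +
        dist B C * dist C A * dist A B = 0 := by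
  have hBCA := not_collinear_rotate hABC
  have hCAB := not_collinear_rotate hBCA
  have hc := dist_pos_of_not_collinear hABC
  have ha := dist_pos_of_not_collinear hBCA
  have hb := dist_pos_of_not_collinear hCAB
  rw [isBisectorFoot_iff hABC] at hA
  rw [isBisectorFoot_iff hBCA] at hB
  rw [isBisectorFoot_iff hCAB] at hC
  have hBA : ‖B - A‖ = dist A B := by rw [dist_comm, dist_eq_norm]
  have hCA : ‖C - A‖ = dist C A := by rw [dist_eq_norm]
  have hCB : ‖(C - A) - (B - A)‖ = dist B C := by
    rw [dist_comm, dist_eq_norm, sub_sub_sub_cancel_right]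
  generalize dist A B = c at *
  generalize dist B C = a at *
  generalize dist C A = b at *
  have e1 : C₁ - A₁ = (b / (a + b) - b / (b + c)) • (B - A) + (-(c / (b + c))) • (C - A) := by
    have h1 : a / (a + b) = 1 - b / (a + b) := by field_simp; ring
    have h2 : b / (b + c) = 1 - c / (b + c) := by field_simp; ring
    rw [hA, hC, h1, h2]
    module
  have e2 : C₁ - B₁ = (b / (a + b)) • (B - A) + (-(c / (c + a))) • (C - A) := by
    have h1 : a / (a + b) = 1 - b / (a + b) := by field_simp; ring
    have h2 : a / (c + a) = 1 - c / (c + a) := by field_simp; ring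
    rw [hB, hC, h1, h2]
    module
  -- Besides the cubic, only b - a and a positive factor appear.
  have hkey : ‖C₁ - A₁‖ ^ 2 - ‖C₁ - B₁‖ ^ 2 =
      (b - a) * (a * b * c * (a + b) / ((a + b) ^ 2 * (b + c) ^ 2 * (c + a) ^ 2)) *
        ((a + b + c) * (a ^ 2 + b ^ 2 - c ^ 2) + a * b * c) := by
    rw [e1, e2, norm_smul_add_smul_sq, norm_smul_add_smul_sq, hBA, hCA, hCB]
    field_simp
    ring
  rw [dist_eq_norm, dist_eq_norm, ← sq_eq_sq₀ (norm_nonneg _) (norm_nonneg _), ← sub_eq_zero, hkey,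
    mul_eq_zero, or_iff_right]
  refine mul_ne_zero (sub_ne_zero.2 hab.symm) ?_
  positivity

open Real in
/-- The cubic relation between the sides, expressed through the angles. -/
theorem cubic_eq_zero_iff {A B C : ℂ} (hABC : ¬ Collinear ℝ {A, B, C}) :
    (dist B C + dist C A + dist A B) * (dist B C ^ 2 + dist C A ^ 2 - dist A B ^ 2) +
        dist B C * dist C A * dist A B = 0 ↔
      2 * cos (∠ B C A) * (sin (∠ C A B) + sin (∠ A B C) + sin (∠ B C A)) + sin (∠ B C A) = 0 := by
  have hBCA := not_collinear_rotate hABC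
  have hCAB := not_collinear_rotate hBCA
  have hc := dist_pos_of_not_collinear hABC
  have ha := dist_pos_of_not_collinear hBCA
  have hb := dist_pos_of_not_collinear hCAB
  have hs := EuclideanGeometry.sin_pos_of_not_collinear hCAB
  have hcos := EuclideanGeometry.law_cos B C A
  have hsin₁ := EuclideanGeometry.law_sin A B C
  have hsin₂ := EuclideanGeometry.law_sin C A B
  rw [dist_comm B A, dist_comm A C] at hcos
  generalize dist A B = c at *
  generalize dist B C = a at *
  generalize dist C A = b at *
  generalize sin (∠ C A B) = x at *
  generalize sin (∠ A B C) = y at *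
  generalize sin (∠ B C A) = z at *
  generalize cos (∠ B C A) = k at *
  -- The law of sines makes the sides proportional to the sines, and a² + b² - c² = 2abk by the law
  -- of cosines.
  have hk : x * ((a + b + c) * (a ^ 2 + b ^ 2 - c ^ 2) + a * b * c) =
      a ^ 2 * b * (2 * k * (x + y + z) + z) := by
    have hy : y * a = x * b := by linarith
    have hz : z * a = x * c := by linarith
    have : a ^ 2 + b ^ 2 - c ^ 2 = 2 * a * b * k := by linarith
    rw [this]
    linear_combination (-2 * a * b * k) * hy - (2 * a * b * k + a * b) * hz
  rw [← mul_right_inj' hs.ne', mul_zero, hk, mul_eq_zero, or_iff_right]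
  positivity

/-! ### Angles and distances on a circle; congruence of triangles. -/

/-- The **inscribed angle theorem** on the circle `o + w x`, `‖x‖ = 1`. -/
theorem exp_two_mul_angle_eq_or {o w x y z : ℂ} (hw : w ≠ 0) (hx : ‖x‖ = 1) (hy : ‖y‖ = 1)
    (hz : ‖z‖ = 1) (hxy : x ≠ y) (hxz : x ≠ z) :
    Complex.exp (2 * ∠ (o + w * z) (o + w * x) (o + w * y) * Complex.I) = z / y ∨
      Complex.exp (2 * ∠ (o + w * z) (o + w * x) (o + w * y) * Complex.I) = y / z := by
  have hx0 : x ≠ 0 := norm_ne_zero_iff.1 (by rw [hx]; exact one_ne_zero)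
  have hy0 : y ≠ 0 := norm_ne_zero_iff.1 (by rw [hy]; exact one_ne_zero)
  have hz0 : z ≠ 0 := norm_ne_zero_iff.1 (by rw [hz]; exact one_ne_zero)
  have hyx := sub_ne_zero.2 hxy.symm
  have hzx := sub_ne_zero.2 hxz.symm
  have hxy' := sub_ne_zero.2 hxy
  set Z : ℂ := (z - x) / (y - x) with hZ
  have hZ0 : Z ≠ 0 := div_ne_zero hzx hyx
  have hang : ∠ (o + w * z) (o + w * x) (o + w * y) = |Z.arg| := by
    have e1 : o + w * z - (o + w * x) = w * (z - x) := by ring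
    have e2 : o + w * y - (o + w * x) = w * (y - x) := by ring
    rw [EuclideanGeometry.angle, vsub_eq_sub, vsub_eq_sub, e1, e2,
      Complex.angle_eq_abs_arg (mul_ne_zero hw hzx) (mul_ne_zero hw hyx), mul_div_mul_left _ _ hw]
  -- On the unit circle conjugation is inversion, so e^{2i arg Z} is Z divided by its conjugate,
  -- that is z/y. The unoriented angle |arg Z| loses the sign, hence two alternatives.
  have hconj : (starRingEnd ℂ) Z = y / z * Z := by
    rw [hZ, map_div₀, map_sub, map_sub, ← Complex.inv_eq_conj hx, ← Complex.inv_eq_conj hy,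
      ← Complex.inv_eq_conj hz]
    have : y⁻¹ - x⁻¹ ≠ 0 := by
      rw [sub_ne_zero]
      exact fun h => hxy (inv_injective h).symm
    field_simp
    ring
  have hexp : Complex.exp (2 * Z.arg * Complex.I) = z / y := by
    have h1 := Complex.norm_mul_exp_arg_mul_I Z
    have hn : (‖Z‖ : ℂ) ≠ 0 := by exact_mod_cast norm_ne_zero_iff.2 hZ0
    have h2 : (starRingEnd ℂ) Z = ‖Z‖ * Complex.exp (-(Z.arg * Complex.I)) := by
      conv_lhs => rw [← h1]
      rw [map_mul, Complex.conj_ofReal, ← Complex.exp_conj, map_mul, Complex.conj_ofReal,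
        Complex.conj_I, mul_neg]
    rw [hconj] at h2
    nth_rewrite 1 [← h1] at h2
    have h3 : y / z * Complex.exp (Z.arg * Complex.I) = Complex.exp (-(Z.arg * Complex.I)) := by
      apply mul_left_cancel₀ hn
      linear_combination h2
    have h4 : Complex.exp (2 * Z.arg * Complex.I) =
        Complex.exp (Z.arg * Complex.I) * Complex.exp (Z.arg * Complex.I) := by
      rw [← Complex.exp_add]
      ring_nf
    have h5 : Complex.exp (-(Z.arg * Complex.I)) * Complex.exp (Z.arg * Complex.I) = 1 := by
      rw [← Complex.exp_add, neg_add_cancel, Complex.exp_zero]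
    rw [h4, eq_div_iff hy0]
    rw [← h3] at h5
    field_simp at h5
    linear_combination h5
  rw [hang]
  rcases abs_choice Z.arg with h | h
  · left
    rw [h, hexp]
  · right
    rw [h, ← inv_div, ← hexp, ← Complex.exp_neg]
    push_cast
    ring_nf

theorem norm_sub_sq_of_norm_eq_one {y z : ℂ} (hy : ‖y‖ = 1) (hz : ‖z‖ = 1) :
    ‖y - z‖ ^ 2 = 2 - 2 * (z / y).re := by
  have hy0 : y ≠ 0 := norm_ne_zero_iff.1 (by rw [hy]; exact one_ne_zero)
  have h1 : ‖y - z‖ = ‖1 - z / y‖ := by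
    rw [← one_mul ‖1 - z / y‖, ← hy, ← norm_mul]
    congr 1
    field_simp
  have h2 : ‖z / y‖ = 1 := by rw [norm_div, hy, hz, div_one]
  rw [h1, norm_sub_sq_real, h2, norm_one, Complex.inner]
  simp
  ring

/-- The **extended law of sines** on the circle `o + w x`, `‖x‖ = 1`. -/
theorem dist_eq_two_mul_sin_angle {o w x y z : ℂ} (hw : w ≠ 0) (hx : ‖x‖ = 1) (hy : ‖y‖ = 1)
    (hz : ‖z‖ = 1) (hxy : x ≠ y) (hxz : x ≠ z) :
    dist (o + w * y) (o + w * z) =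
      2 * ‖w‖ * Real.sin (∠ (o + w * z) (o + w * x) (o + w * y)) := by
  have h := exp_two_mul_angle_eq_or (o := o) hw hx hy hz hxy hxz
  have hsin := sin_angle_nonneg ((o + w * z) -ᵥ (o + w * x)) ((o + w * y) -ᵥ (o + w * x))
  change 0 ≤ Real.sin (∠ (o + w * z) (o + w * x) (o + w * y)) at hsin
  generalize ∠ (o + w * z) (o + w * x) (o + w * y) = θ at *
  have e : dist (o + w * y) (o + w * z) = ‖w‖ * ‖y - z‖ := by
    rw [dist_eq_norm, ← norm_mul]
    ring_nf
  have hre : (Complex.exp (2 * θ * Complex.I)).re = Real.cos (2 * θ) := by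
    rw [show (2 * θ * Complex.I : ℂ) = ((2 * θ : ℝ) : ℂ) * Complex.I by push_cast; ring,
      Complex.exp_ofReal_mul_I_re]
  have hsq : ‖y - z‖ ^ 2 = (2 * Real.sin θ) ^ 2 := by
    have h3 : ‖y - z‖ ^ 2 = 2 - 2 * Real.cos (2 * θ) := by
      rcases h with h | h
      · rw [norm_sub_sq_of_norm_eq_one hy hz, ← h, hre]
      · rw [norm_sub_rev, norm_sub_sq_of_norm_eq_one hz hy, ← h, hre]
    rw [h3, Real.cos_two_mul, mul_pow, Real.sin_sq]
    ring
  have h4 : ‖y - z‖ = 2 * Real.sin θ :=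
    (sq_eq_sq₀ (norm_nonneg _) (by positivity)).1 hsq
  rw [e, h4]
  ring

/-- Triangles in the plane with equal sides are related by an isometry of the plane. -/
theorem exists_isometryEquiv_of_dist_eq {A B C A' B' C' : ℂ} (hAB : A ≠ B)
    (h₁ : dist A B = dist A' B') (h₂ : dist B C = dist B' C') (h₃ : dist C A = dist C' A') :
    ∃ e : ℂ ≃ᵢ ℂ, e A = A' ∧ e B = B' ∧ e C = C' := by
  have hBA : B - A ≠ 0 := sub_ne_zero.2 hAB.symm
  have hAB' : A' ≠ B' := by
    rw [← dist_pos, ← h₁, dist_pos]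
    exact hAB
  have hBA' : B' - A' ≠ 0 := sub_ne_zero.2 hAB'.symm
  have hnorm : ‖B - A‖ = ‖B' - A'‖ := by
    rw [← dist_eq_norm, ← dist_eq_norm, dist_comm, h₁, dist_comm]
  set Z := (C - A) / (B - A) with hZ
  set Z' := (C' - A') / (B' - A') with hZ'
  have hC : C = A + Z * (B - A) := by rw [hZ]; field_simp; ring
  have hC' : C' = A' + Z' * (B' - A') := by rw [hZ']; field_simp; ring
  have hZn : ‖Z‖ = ‖Z'‖ := by
    rw [hZ, hZ', norm_div, norm_div, ← dist_eq_norm C A, ← dist_eq_norm C' A', hnorm, h₃]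
  have hZn1 : ‖Z - 1‖ = ‖Z' - 1‖ := by
    have e1 : Z - 1 = (C - B) / (B - A) := by rw [hZ]; field_simp; ring
    have e2 : Z' - 1 = (C' - B') / (B' - A') := by rw [hZ']; field_simp; ring
    rw [e1, e2, norm_div, norm_div, ← dist_eq_norm C B, ← dist_eq_norm C' B', hnorm,
      dist_comm C B, dist_comm C' B', h₂]
  -- |Z| and |Z - 1| determine Z up to conjugation: the isometry is a rotation with translations,
  -- preceded by a reflection in the second case.
  have hZZ : Z' = Z ∨ Z' = (starRingEnd ℂ) Z := by
    have s1 : Complex.normSq Z = Complex.normSq Z' := by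
      rw [Complex.normSq_eq_norm_sq, Complex.normSq_eq_norm_sq, hZn]
    have s2 : Complex.normSq (Z - 1) = Complex.normSq (Z' - 1) := by
      rw [Complex.normSq_eq_norm_sq, Complex.normSq_eq_norm_sq, hZn1]
    simp only [Complex.normSq_apply, Complex.sub_re, Complex.sub_im, Complex.one_re,
      Complex.one_im] at s1 s2
    have hre : Z'.re = Z.re := by linarith
    have him : Z'.im ^ 2 = Z.im ^ 2 := by
      rw [hre] at s1
      linarith
    rcases sq_eq_sq_iff_eq_or_eq_neg.1 him with h | h
    · exact Or.inl (Complex.ext hre h)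
    · exact Or.inr (Complex.ext hre h)
  rcases hZZ with h | h
  · have hl : ‖(B' - A') / (B - A)‖ = 1 := by
      rw [norm_div, hnorm, div_self (norm_ne_zero_iff.2 hBA')]
    let l : Circle := ⟨(B' - A') / (B - A), mem_sphere_zero_iff_norm.2 hl⟩
    have he : ∀ p, ((IsometryEquiv.addRight (-A)).trans ((rotation l).toIsometryEquiv.trans
        (IsometryEquiv.addRight A'))) p = (B' - A') / (B - A) * (p - A) + A' := fun p => by
      rw [sub_eq_add_neg p A]
      rfl
    refine ⟨_, (he A).trans (by simp), (he B).trans ?_, (he C).trans ?_⟩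
    · field_simp
      ring
    · rw [hC', hC, h]
      field_simp
      ring
  · have hcBA : (starRingEnd ℂ) (B - A) ≠ 0 := (map_ne_zero _).2 hBA
    have hl : ‖(B' - A') / (starRingEnd ℂ) (B - A)‖ = 1 := by
      rw [norm_div, Complex.norm_conj, hnorm, div_self (norm_ne_zero_iff.2 hBA')]
    let l : Circle := ⟨(B' - A') / (starRingEnd ℂ) (B - A), mem_sphere_zero_iff_norm.2 hl⟩
    have he : ∀ p, ((IsometryEquiv.addRight (-A)).trans (Complex.conjLIE.toIsometryEquiv.trans
        ((rotation l).toIsometryEquiv.trans (IsometryEquiv.addRight A')))) p =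
          (B' - A') / (starRingEnd ℂ) (B - A) * (starRingEnd ℂ) (p - A) + A' := fun p => by
      rw [sub_eq_add_neg p A]
      rfl
    refine ⟨_, (he A).trans (by simp), (he B).trans ?_, (he C).trans ?_⟩
    · rw [div_mul_cancel₀ _ hcBA]
      ring
    · rw [hC', hC, h, add_sub_cancel_left, map_mul]
      field_simp
      ring

/-! ### Classification of Sharygin triangles in regular polygons. -/

/-- The vertices of a regular polygon as points `o + w x` with `x` a root of unity. -/
theorem exists_param_of_mem_regularPolygon {r : ℝ} {V : Set ℂ}
    (hV : IsRegularPolygonVertexSet r V) : ∃ (n : ℕ) (o w : ℂ), 0 < n ∧ w ≠ 0 ∧ ‖w‖ = r ∧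
      ∀ P ∈ V, ∃ x : ℂ, ‖x‖ = 1 ∧ x ^ n = 1 ∧ P = o + w * x := by
  obtain ⟨hr, n, o, w, hn, hw, rfl⟩ := hV
  refine ⟨n, o, w, by omega, norm_ne_zero_iff.1 (by rw [hw]; exact hr.ne'), hw, ?_⟩
  rintro _ ⟨k, rfl⟩
  have hn0 : (n : ℂ) ≠ 0 := by
    have : n ≠ 0 := by omega
    exact_mod_cast this
  have hpow : Complex.exp (2 * (π : ℂ) * Complex.I * ((k : ℕ) : ℂ) / (n : ℂ)) ^ n = 1 := by
    rw [← Complex.exp_nat_mul, Complex.exp_eq_one_iff]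
    exact ⟨k, by field_simp; push_cast; ring⟩
  exact ⟨_, Complex.norm_eq_one_of_pow_eq_one hpow (by omega), hpow, rfl⟩

/-- If the bisectral triangle of a scalene triangle with vertices in a regular polygon has equal
sides at `C₁`, then the angle at `C` is `4π/7`, and the other two are `π/7` and `2π/7`. -/
theorem angles_eq_of_dist_bisectorFoot_eq {r : ℝ} {V : Set ℂ}
    (hV : IsRegularPolygonVertexSet r V) {A B C A₁ B₁ C₁ : ℂ} (hABC : ¬ Collinear ℝ {A, B, C})
    (hA : A ∈ V) (hB : B ∈ V) (hC : C ∈ V)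
    (hA₁ : IsBisectorFoot A B C A₁) (hB₁ : IsBisectorFoot B C A B₁) (hC₁ : IsBisectorFoot C A B C₁)
    (hab : dist C B ≠ dist C A) (h : dist C₁ A₁ = dist C₁ B₁) :
    ∠ B C A = 4 * π / 7 ∧ ((∠ C A B = π / 7 ∧ ∠ A B C = 2 * π / 7) ∨
      (∠ C A B = 2 * π / 7 ∧ ∠ A B C = π / 7)) := by
  have hBCA := not_collinear_rotate hABC
  have hCAB := not_collinear_rotate hBCA
  rw [dist_bisectorFoot_eq_iff hABC hA₁ hB₁ hC₁ (by rwa [dist_comm B C]),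
    cubic_eq_zero_iff hABC] at h
  obtain ⟨n, o, w, hn, hw, -, hVx⟩ := exists_param_of_mem_regularPolygon hV
  obtain ⟨x, hx, hxn, rfl⟩ := hVx A hA
  obtain ⟨y, hy, hyn, rfl⟩ := hVx B hB
  obtain ⟨z, hz, hzn, rfl⟩ := hVx C hC
  have hxy : x ≠ y := by
    rintro rfl
    exact ne₁₂_of_not_collinear hABC rfl
  have hyz : y ≠ z := by
    rintro rfl
    exact ne₁₂_of_not_collinear hBCA rfl
  have hzx : z ≠ x := by
    rintro rfl
    exact ne₁₂_of_not_collinear hCAB rfl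
  have hsum := EuclideanGeometry.angle_add_angle_add_angle_eq_pi (o + w * z)
    (ne₁₂_of_not_collinear hABC).symm
  refine angles_eq_of_rational (EuclideanGeometry.angle_pos_of_not_collinear hCAB)
    (EuclideanGeometry.angle_pos_of_not_collinear hABC)
    (EuclideanGeometry.angle_pos_of_not_collinear hBCA) ?_ ?_ h hn ?_ ?_
  · linarith
  · intro heq
    apply hab
    apply (EuclideanGeometry.dist_eq_of_angle_eq_angle_of_angle_ne_pi ?_ ?_).symm
    · rw [heq, EuclideanGeometry.angle_comm]
    · intro hpi
      exact hBCA (EuclideanGeometry.collinear_of_angle_eq_pi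
        (by rwa [EuclideanGeometry.angle_comm] at hpi))
  · rcases exp_two_mul_angle_eq_or (o := o) hw hx hy hz hxy hzx.symm with e | e <;>
      rw [e, div_pow, hyn, hzn, div_one]
  · rcases exp_two_mul_angle_eq_or (o := o) hw hy hz hx hyz hxy.symm with e | e <;>
      rw [e, div_pow, hxn, hzn, div_one]

theorem Affine.Triangle.not_collinear (T : Affine.Triangle ℝ ℂ) {i j k : Fin 3} (hij : i ≠ j)
    (hik : i ≠ k) (hjk : j ≠ k) : ¬ Collinear ℝ {T.points i, T.points j, T.points k} :=
  (affineIndependent_iff_not_collinear_of_ne hij hik hjk).1 T.independent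

/-- Stated for the inverse permutation because `Affine.Simplex.reindex` composes the vertices with
`σ.symm`. -/
theorem exists_perm_symm_apply_eq : ∀ {i j k : Fin 3}, i ≠ j → i ≠ k → j ≠ k →
    ∃ σ : Equiv.Perm (Fin 3), σ.symm 0 = i ∧ σ.symm 1 = j ∧ σ.symm 2 = k := by
  decide

/-- A Sharygin triangle with vertices in a regular polygon is heptagonal, up to relabelling. -/
theorem IsSharygin.exists_isHeptagonal_reindex {T : Affine.Triangle ℝ ℂ} (hT : IsSharygin T)
    {r : ℝ} (hr : HasVerticesInRegularPolygon r T) :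
    ∃ σ : Equiv.Perm (Fin 3), IsHeptagonal (T.reindex σ) := by
  obtain ⟨hiso, A₁, B₁, C₁, hA, hB, hC, h⟩ := hT
  obtain ⟨V, hV, hTV⟩ := hr
  have hmem : ∀ i, T.points i ∈ V := fun i => hTV ⟨i, rfl⟩
  have hperm : ∀ {i j k : Fin 3}, i ≠ j → i ≠ k → j ≠ k →
      (∠ (T.points j) (T.points k) (T.points i) = 4 * π / 7 ∧
        ((∠ (T.points k) (T.points i) (T.points j) = π / 7 ∧
          ∠ (T.points i) (T.points j) (T.points k) = 2 * π / 7) ∨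
        (∠ (T.points k) (T.points i) (T.points j) = 2 * π / 7 ∧
          ∠ (T.points i) (T.points j) (T.points k) = π / 7))) →
      ∃ σ : Equiv.Perm (Fin 3), IsHeptagonal (T.reindex σ) := by
    rintro i j k hij hik hjk ⟨h1, ⟨h2, h3⟩ | ⟨h2, h3⟩⟩
    · obtain ⟨σ, s0, s1, s2⟩ := exists_perm_symm_apply_eq hij hik hjk
      refine ⟨σ, ?_⟩
      simp only [IsHeptagonal, Affine.Simplex.reindex_points, Function.comp_apply, s0, s1, s2]
      exact ⟨h2, h3, h1⟩
    · obtain ⟨σ, s0, s1, s2⟩ := exists_perm_symm_apply_eq hij.symm hjk hik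
      refine ⟨σ, ?_⟩
      simp only [IsHeptagonal, Affine.Simplex.reindex_points, Function.comp_apply, s0, s1, s2]
      exact ⟨(EuclideanGeometry.angle_comm _ _ _).trans h3,
        (EuclideanGeometry.angle_comm _ _ _).trans h2, (EuclideanGeometry.angle_comm _ _ _).trans h1⟩
  simp only [IsIsosceles, not_or] at hiso
  obtain ⟨n1, n2, n3⟩ := hiso
  rcases h with h | h | h
  · exact hperm (i := 1) (j := 2) (k := 0) (by decide) (by decide) (by decide)
      (angles_eq_of_dist_bisectorFoot_eq hV (T.not_collinear (by decide) (by decide) (by decide))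
        (hmem 1) (hmem 2) (hmem 0) hB hC hA (Ne.symm n1) h)
  · exact hperm (i := 2) (j := 0) (k := 1) (by decide) (by decide) (by decide)
      (angles_eq_of_dist_bisectorFoot_eq hV (T.not_collinear (by decide) (by decide) (by decide))
        (hmem 2) (hmem 0) (hmem 1) hC hA hB n2 h.symm)
  · exact hperm (i := 0) (j := 1) (k := 2) (by decide) (by decide) (by decide)
      (angles_eq_of_dist_bisectorFoot_eq hV (T.not_collinear (by decide) (by decide) (by decide))
        (hmem 0) (hmem 1) (hmem 2) hA hB hC (Ne.symm n3) h)

/-- Heptagonal triangles are similar. -/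
theorem IsHeptagonal.similar {T H : Affine.Triangle ℝ ℂ} (hT : IsHeptagonal T)
    (hH : IsHeptagonal H) : Similar T.points H.points := by
  have heta : ∀ S : Affine.Triangle ℝ ℂ, S.points = ![S.points 0, S.points 1, S.points 2] := by
    intro S
    ext i
    fin_cases i <;> rfl
  rw [heta T, heta H]
  exact EuclideanGeometry.similar_of_angle_angle
    (T.not_collinear (by decide) (by decide) (by decide))
    (hT.2.1.trans hH.2.1.symm) (hT.2.2.trans hH.2.2.symm)

/-! ### Existence and uniqueness for circumradius one. -/

/-- A triangle with angles `π/7`, `2π/7`, `4π/7` is a Sharygin triangle. -/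
theorem IsHeptagonal.isSharygin {T : Affine.Triangle ℝ ℂ} (hT : IsHeptagonal T) :
    IsSharygin T := by
  obtain ⟨h0, h1, h2⟩ := hT
  have hπ := Real.pi_pos
  have hABC : ¬ Collinear ℝ {T.points 0, T.points 1, T.points 2} :=
    T.not_collinear (by decide) (by decide) (by decide)
  have hBCA := not_collinear_rotate hABC
  have hCAB := not_collinear_rotate hBCA
  have hiso : ¬ IsIsosceles (T.points 0) (T.points 1) (T.points 2) := by
    rintro (h | h | h)
    · have := EuclideanGeometry.angle_eq_angle_of_dist_eq h
      rw [EuclideanGeometry.angle_comm (T.points 0) (T.points 2), h1, h2] at this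
      linarith
    · have := EuclideanGeometry.angle_eq_angle_of_dist_eq h
      rw [EuclideanGeometry.angle_comm (T.points 1) (T.points 0), h0, h2] at this
      linarith
    · have := EuclideanGeometry.angle_eq_angle_of_dist_eq h
      rw [EuclideanGeometry.angle_comm (T.points 2) (T.points 1), h0, h1] at this
      linarith
  refine ⟨hiso, _, _, _, (isBisectorFoot_iff hABC).2 rfl, (isBisectorFoot_iff hBCA).2 rfl,
    (isBisectorFoot_iff hCAB).2 rfl, Or.inr (Or.inr ?_)⟩
  rw [dist_bisectorFoot_eq_iff hABC ((isBisectorFoot_iff hABC).2 rfl)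
    ((isBisectorFoot_iff hBCA).2 rfl) ((isBisectorFoot_iff hCAB).2 rfl)
    (fun h => hiso (Or.inr (Or.inr (by rw [h.symm, dist_comm])))), cubic_eq_zero_iff hABC, h0, h1,
    h2, two_mul_cos_mul_add_sin_eq (by ring)]
  -- Here d = -π/14, so 2s - d is the right angle and the other two cosines cancel.
  have e1 : 2 * ((π / 7 + 2 * π / 7) / 2) - (π / 7 - 2 * π / 7) / 2 = π / 2 := by ring
  have e2 : 3 * ((π / 7 + 2 * π / 7) / 2) =
      π - (2 * ((π / 7 + 2 * π / 7) / 2) + (π / 7 - 2 * π / 7) / 2) := by ring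
  rw [e1, e2, Real.cos_pi_sub, Real.cos_pi_div_two]
  ring

/-- The sides of a triangle inscribed in a regular polygon. -/
theorem HasVerticesInRegularPolygon.dist_eq {r : ℝ} {T : Affine.Triangle ℝ ℂ}
    (hT : HasVerticesInRegularPolygon r T) {i j k : Fin 3} (hij : i ≠ j) (hik : i ≠ k)
    (hjk : j ≠ k) :
    dist (T.points j) (T.points k) =
      2 * r * Real.sin (∠ (T.points k) (T.points i) (T.points j)) := by
  obtain ⟨V, hV, hTV⟩ := hT
  have hABC := T.not_collinear hij hik hjk
  obtain ⟨n, o, w, hn, hw, hwr, hVx⟩ := exists_param_of_mem_regularPolygon hV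
  obtain ⟨x, hx, -, hxe⟩ := hVx _ (hTV ⟨i, rfl⟩)
  obtain ⟨y, hy, -, hye⟩ := hVx _ (hTV ⟨j, rfl⟩)
  obtain ⟨z, hz, -, hze⟩ := hVx _ (hTV ⟨k, rfl⟩)
  rw [hxe, hye, hze] at hABC
  rw [hxe, hye, hze, ← hwr]
  refine dist_eq_two_mul_sin_angle hw hx hy hz ?_ ?_
  · rintro rfl
    exact ne₁₂_of_not_collinear hABC rfl
  · rintro rfl
    exact ne₁₃_of_not_collinear hABC rfl

/-- Up to inversion, e^{2iθ} fixes θ only up to sign and modulo π, which leaves two values in [0,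
π]. -/
theorem eq_or_eq_pi_sub_of_exp_two_mul {θ φ : ℝ} {q : ℂ} (hθ : 0 ≤ θ) (hθ' : θ ≤ π) (hφ : 0 ≤ φ)
    (hφ' : φ ≤ π) (hq : q = Complex.exp (2 * φ * Complex.I))
    (h : Complex.exp (2 * θ * Complex.I) = q ∨ Complex.exp (2 * θ * Complex.I) = q⁻¹) :
    θ = φ ∨ θ = π - φ := by
  have hre : ∀ x : ℝ, (Complex.exp (2 * x * Complex.I)).re = Real.cos (2 * x) := by
    intro x
    rw [show (2 * x * Complex.I : ℂ) = ((2 * x : ℝ) : ℂ) * Complex.I by push_cast; ring,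
      Complex.exp_ofReal_mul_I_re]
  have hcos : Real.cos (2 * θ) = Real.cos (2 * φ) := by
    rw [← hre θ]
    rcases h with h | h
    · rw [h, hq, hre]
    · rw [h, hq, ← Complex.exp_neg, show -(2 * φ * Complex.I : ℂ) = 2 * ((-φ : ℝ) : ℂ) * Complex.I
        by push_cast; ring, hre, mul_neg, Real.cos_neg]
  rw [Real.cos_two_mul, Real.cos_two_mul] at hcos
  have hsq : Real.cos θ ^ 2 = Real.cos φ ^ 2 := by linarith
  rcases sq_eq_sq_iff_eq_or_eq_neg.1 hsq with h | h
  · exact Or.inl (Real.injOn_cos ⟨hθ, hθ'⟩ ⟨hφ, hφ'⟩ h)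
  · rw [← Real.cos_pi_sub] at h
    exact Or.inr (Real.injOn_cos ⟨hθ, hθ'⟩ ⟨by linarith, by linarith⟩ h)

/-- The regular heptagon inscribed in the unit circle contains a heptagonal triangle. -/
theorem exists_isHeptagonal_hasVerticesInRegularPolygon :
    ∃ T : Affine.Triangle ℝ ℂ, IsHeptagonal T ∧ HasVerticesInRegularPolygon 1 T := by
  have hζ : IsPrimitiveRoot (Complex.exp (2 * π * Complex.I / (7 : ℕ))) 7 :=
    Complex.isPrimitiveRoot_exp 7 (by norm_num)
  have hpow : ∀ k : ℕ, Complex.exp (2 * π * Complex.I / (7 : ℕ)) ^ k =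
      Complex.exp (2 * ((k * π / 7 : ℝ) : ℂ) * Complex.I) := by
    intro k
    rw [← Complex.exp_nat_mul]
    push_cast
    ring_nf
  set ζ := Complex.exp (2 * π * Complex.I / (7 : ℕ)) with hζdef
  have hnorm : ∀ k : ℕ, ‖ζ ^ k‖ = 1 := by
    intro k
    rw [norm_pow, hζ.norm'_eq_one (by norm_num), one_pow]
  have h51 : ζ ^ 5 ≠ ζ ^ 1 := fun h =>
    absurd (hζ.pow_inj (by norm_num) (by norm_num) h) (by norm_num)
  have h50 : ζ ^ 5 ≠ ζ ^ 0 := fun h =>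
    absurd (hζ.pow_inj (by norm_num) (by norm_num) h) (by norm_num)
  have h10 : ζ ^ 1 ≠ ζ ^ 0 := fun h =>
    absurd (hζ.pow_inj (by norm_num) (by norm_num) h) (by norm_num)
  -- The exponents 5, 1, 0 cut the heptagon into arcs of 1, 2 and 4 steps, opposite the vertices in
  -- this order.
  have hind : AffineIndependent ℝ ![ζ ^ 5, ζ ^ 1, ζ ^ 0] := by
    refine EuclideanGeometry.Cospherical.affineIndependent_of_ne ⟨0, 1, ?_⟩ h51 h50 h10
    rintro p (rfl | rfl | rfl) <;> rw [dist_zero_right, hnorm]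
  refine ⟨⟨_, hind⟩, ?_, ?_⟩
  · have hA := exp_two_mul_angle_eq_or (o := 0) one_ne_zero (hnorm 5) (hnorm 1) (hnorm 0) h51 h50
    have hB := exp_two_mul_angle_eq_or (o := 0) one_ne_zero (hnorm 1) (hnorm 0) (hnorm 5) h10
      h51.symm
    have hC := exp_two_mul_angle_eq_or (o := 0) one_ne_zero (hnorm 0) (hnorm 5) (hnorm 1) h50.symm
      h10.symm
    have hsum := EuclideanGeometry.angle_add_angle_add_angle_eq_pi (ζ ^ 0) h51.symm
    simp only [zero_add, one_mul] at hA hB hC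
    have hπ := Real.pi_pos
    have hA' := eq_or_eq_pi_sub_of_exp_two_mul (φ := π / 7) (q := ζ ^ 1 / ζ ^ 0)
      (EuclideanGeometry.angle_nonneg _ _ _) (EuclideanGeometry.angle_le_pi _ _ _)
      (by linarith) (by linarith)
      (by rw [pow_zero, div_one, hpow]; push_cast; ring_nf) (by rw [inv_div]; exact hA.symm)
    have hB' := eq_or_eq_pi_sub_of_exp_two_mul (φ := 5 * π / 7) (q := ζ ^ 5 / ζ ^ 0)
      (EuclideanGeometry.angle_nonneg _ _ _) (EuclideanGeometry.angle_le_pi _ _ _)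
      (by linarith) (by linarith)
      (by rw [pow_zero, div_one, hpow]; push_cast; ring_nf) (by rw [inv_div]; exact hB)
    have hC' := eq_or_eq_pi_sub_of_exp_two_mul (φ := 4 * π / 7) (q := ζ ^ 5 / ζ ^ 1)
      (EuclideanGeometry.angle_nonneg _ _ _) (EuclideanGeometry.angle_le_pi _ _ _)
      (by linarith) (by linarith)
      (by
        rw [div_eq_iff (pow_ne_zero _ (hζ.ne_zero (by norm_num))), hpow, hpow, ← Complex.exp_add]
        push_cast
        ring_nf)
      (by rw [inv_div]; exact hC.symm)
    change ∠ (ζ ^ 0) (ζ ^ 5) (ζ ^ 1) = π / 7 ∧ ∠ (ζ ^ 5) (ζ ^ 1) (ζ ^ 0) = 2 * π / 7 ∧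
      ∠ (ζ ^ 1) (ζ ^ 0) (ζ ^ 5) = 4 * π / 7
    -- Of the eight combinations only π/7, 2π/7, 4π/7 has sum π.
    rcases hA' with hA' | hA' <;> rcases hB' with hB' | hB' <;> rcases hC' with hC' | hC' <;>
      exact ⟨by linarith, by linarith, by linarith⟩
  · refine ⟨_, ⟨one_pos, 7, 0, 1, by norm_num, norm_one, rfl⟩, ?_⟩
    have hmem : ∀ k : Fin 7, ζ ^ (k : ℕ) ∈ Set.range fun k : Fin 7 =>
        (0 : ℂ) + 1 * Complex.exp (2 * (π : ℂ) * Complex.I * ((k : ℕ) : ℂ) / ((7 : ℕ) : ℂ)) := by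
      intro k
      refine ⟨k, ?_⟩
      simp only [zero_add, one_mul]
      rw [hpow]
      push_cast
      ring_nf
    rintro _ ⟨i, rfl⟩
    fin_cases i
    · exact hmem 5
    · exact hmem 1
    · exact hmem 0

theorem HasVerticesInRegularPolygon.reindex {r : ℝ} {T : Affine.Triangle ℝ ℂ}
    (hT : HasVerticesInRegularPolygon r T) (σ : Equiv.Perm (Fin 3)) :
    HasVerticesInRegularPolygon r (T.reindex σ) := by
  obtain ⟨V, hV, hTV⟩ := hT
  exact ⟨V, hV, by rwa [Affine.Simplex.reindex_range_points]⟩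

/-- Heptagonal triangles inscribed in regular polygons with equal circumradii are congruent. -/
theorem IsHeptagonal.exists_isometryEquiv {r : ℝ} {T S : Affine.Triangle ℝ ℂ}
    (hT : IsHeptagonal T) (hS : IsHeptagonal S) (hTr : HasVerticesInRegularPolygon r T)
    (hSr : HasVerticesInRegularPolygon r S) :
    ∃ e : ℂ ≃ᵢ ℂ, e '' Set.range T.points = Set.range S.points := by
  have d0 : (0 : Fin 3) ≠ 1 := by decide
  have d1 : (1 : Fin 3) ≠ 2 := by decide
  have d2 : (2 : Fin 3) ≠ 0 := by decide
  obtain ⟨e, e0, e1, e2⟩ := exists_isometryEquiv_of_dist_eq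
    (A' := S.points 0) (B' := S.points 1) (C' := S.points 2)
    (ne₁₂_of_not_collinear (T.not_collinear d0 d2.symm d1))
    (by rw [hTr.dist_eq d2 d1.symm d0, hSr.dist_eq d2 d1.symm d0, hT.2.2, hS.2.2])
    (by rw [hTr.dist_eq d0 d2.symm d1, hSr.dist_eq d0 d2.symm d1, hT.1, hS.1])
    (by rw [hTr.dist_eq d1 d0.symm d2, hSr.dist_eq d1 d0.symm d2, hT.2.1, hS.2.1])
  refine ⟨e, ?_⟩
  rw [← Set.range_comp]
  congr 1
  ext i
  fin_cases i
  · exact e0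
  · exact e1
  · exact e2

theorem mainTheorem2 :
    -- a Sharygin triangle with vertices in a regular polygon has angles `π/7`, `2π/7`, `4π/7`
    -- after relabelling, and is similar to every triangle with these angles
    (∀ (T : Affine.Triangle ℝ ℂ) (r : ℝ), IsSharygin T → HasVerticesInRegularPolygon r T →
      (∃ σ : Equiv.Perm (Fin 3), IsHeptagonal (T.reindex σ)) ∧
      ∀ H : Affine.Triangle ℝ ℂ, IsHeptagonal H →
        ∃ σ : Equiv.Perm (Fin 3), Similar (T.reindex σ).points H.points) ∧
    -- for circumradius one, such a triangle exists and is unique up to an isometry of the plane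
    (∃ T₀ : Affine.Triangle ℝ ℂ, IsSharygin T₀ ∧ HasVerticesInRegularPolygon 1 T₀ ∧
      ∀ T : Affine.Triangle ℝ ℂ, IsSharygin T → HasVerticesInRegularPolygon 1 T →
        ∃ e : ℂ ≃ᵢ ℂ, e '' Set.range T.points = Set.range T₀.points) := by
  refine ⟨fun T r hT hr => ?_, ?_⟩
  · obtain ⟨σ, hσ⟩ := hT.exists_isHeptagonal_reindex hr
    exact ⟨⟨σ, hσ⟩, fun H hH => ⟨σ, hσ.similar hH⟩⟩
  · obtain ⟨T₀, hhep, hr₀⟩ := exists_isHeptagonal_hasVerticesInRegularPolygon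
    refine ⟨T₀, hhep.isSharygin, hr₀, fun T hT hr => ?_⟩
    obtain ⟨σ, hσ⟩ := hT.exists_isHeptagonal_reindex hr
    rw [← Affine.Simplex.reindex_range_points T σ]
    exact hσ.exists_isometryEquiv hhep (hr.reindex σ) hr₀
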